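/- Let $Q$ be a real-analytic, finite-dimensional, Hausdorff, paracompact manifold with tangent bundle $\tau_Q\colon TQ\to Q$, let $\nabla$ be an analytic affine connection on $Q$ (not necessarily torsion-free), and let $\mathscr Y=\{Y_1,\dots,Y_r\}$ be a finite family of analytic vector fields on $Q$. For a vector field $X$ on $Q$ let $X^V$ be its vertical lift, $X^V(v_q)=\frac{d}{dt}\big|_{t=0}(v_q+tX(q))$, and let $Z$ be the geodesic spray of $\nabla$, the vector field on $TQ$ given in coordinates by $Z=v^i\,\partial/\partial q^i-\Gamma^i_{jk}v^jv^k\,\partial/\partial v^i$. Write $\mathrm{ad}_Z W=[Z,W]$ and $\langle X\colon Y\rangle=\nabla_XY+\nabla_YX$. Let $\mathrm{Sym}^{(\infty)}(\mathscr Y)$ be the smallest $\mathbb R$-subspace of vector fields on $Q$ that contains $\mathscr Y$ and is closed under $\langle\cdot\colon\cdot\rangle$. For a set $\mathscr F$ of vector fields on $TQ$, let $\mathrm{Lie}^{(\infty)}(\mathscr F)$ be the smallest $\mathbb R$-subspace of vector fields on $TQ$ that contains $\mathscr F$ and is closed under the Lie bracket. A subscript $v_q$ denotes the set of values at $v_q$.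 Put $$\mathcal A=\{X^V \mid X\in \mathrm{Sym}^{(\infty)}(\mathscr Y)\},\qquad \mathcal B=\mathrm{span}_{\mathbb R}\{\mathrm{ad}_Z^l(X^V)\mid l\ge 0,\ X\in \mathrm{Sym}^{(\infty)}(\mathscr Y)\},$$ $$\mathcal C=\mathrm{Lie}^{(\infty)}\big(\{\mathrm{ad}_Z^l(X^V)\mid l\ge 1,\ X\in \mathrm{Sym}^{(\infty)}(\mathscr Y)\}\big).$$ Theorem. For every $v_q\in TQ$, $$\mathrm{Lie}^{(\infty)}(Z,\mathscr Y^V)_{v_q}=\mathbb R\, Z_{v_q}+\mathcal A_{v_q}+\mathcal B_{v_q}+\mathcal C_{v_q},$$ that is, the accessibility distribution at $v_q$ is spanned by $Z_{v_q}$ and the elements of $\mathcal A_{v_q}$, $\mathcal B_{v_q}$ and $\mathcal C_{v_q}$. Moreover, $\mathcal B$ is the smallest $\mathbb R$-subspace of vector fields on $TQ$ that contains $\mathcal A$ and is invariant under $\mathrm{ad}_Z$. -/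

import Mathlib

open scoped Manifold ContDiff

noncomputable section

namespace AffineControl

/-- The family of all (not necessarily continuous) vector fields on a manifold. -/
abbrev VField {F K : Type*} [NormedAddCommGroup F] [NormedSpace ℝ F] [TopologicalSpace K]
    (J : ModelWithCorners ℝ F K) (M : Type*) [TopologicalSpace M] [ChartedSpace K M] : Type _ :=
  (p : M) → TangentSpace J p

/-- The involutive closure `Lie^(∞)(S)` of a set `S` of vector fields: the smallest real subspace
of vector fields that contains `S` and is closed under the Lie bracket. -/
def lieClosure {F K : Type*} [NormedAddCommGroup F] [NormedSpace ℝ F] [TopologicalSpace K]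
    (J : ModelWithCorners ℝ F K) {M : Type*} [TopologicalSpace M] [ChartedSpace K M]
    (S : Set (VField J M)) : Submodule ℝ (VField J M) :=
  sInf {W | S ⊆ W ∧ ∀ X ∈ W, ∀ Y ∈ W, VectorField.mlieBracket J X Y ∈ W}

/-- The values at the point `p` of a space `W` of vector fields. -/
def valuesAt {F K : Type*} [NormedAddCommGroup F] [NormedSpace ℝ F] [TopologicalSpace K]
    {J : ModelWithCorners ℝ F K} {M : Type*} [TopologicalSpace M] [ChartedSpace K M]
    (W : Submodule ℝ (VField J M)) (p : M) : Submodule ℝ (TangentSpace J p) :=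
  W.map (LinearMap.proj p)

section Connection

variable {E : Type*} [NormedAddCommGroup E] [NormedSpace ℝ E]
  {Q : Type*} [TopologicalSpace Q] [ChartedSpace E Q] [IsManifold 𝓘(ℝ, E) ω Q]

/-- The inclusion `u ↦ u` of the fibre `T_q Q` into `TQ`; the type `E` underlies `T_q Q`. -/
def fibreInclusion (q : Q) (u : E) : TangentBundle 𝓘(ℝ, E) Q := ⟨q, u⟩

/-- The vertical lift `vlft_v w`, i.e. the velocity at `t = 0` of the curve `t ↦ v + t w` in the
fibre through `v`, written as the derivative at `v`, in the direction `w`, of the inclusion of the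
fibre into the tangent bundle. -/
def vlft (v : TangentBundle 𝓘(ℝ, E) Q) (w : TangentSpace 𝓘(ℝ, E) v.proj) :
    TangentSpace 𝓘(ℝ, E).tangent v :=
  let u : E := v.snd
  mfderiv 𝓘(ℝ, E) 𝓘(ℝ, E).tangent (fibreInclusion (Q := Q) v.proj) u w

/-- The vertical lift `X^V`, a vector field on `TQ`, of a vector field `X` on `Q`. -/
def verticalLift (X : VField 𝓘(ℝ, E) Q) :
    VField 𝓘(ℝ, E).tangent (TangentBundle 𝓘(ℝ, E) Q) :=
  fun v ↦ vlft v (X v.proj)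

/-- A vector field of class `C^ω`. -/
def IsAnalyticField (X : VField 𝓘(ℝ, E) Q) : Prop :=
  ContMDiff 𝓘(ℝ, E) 𝓘(ℝ, E).tangent ω (fun q ↦ (⟨q, X q⟩ : TangentBundle 𝓘(ℝ, E) Q))

/-- An affine connection on `Q` is a covariant derivative on `TQ`; the value of `∇_X Y` at `q` is
`cov Y q (X q)`. It is analytic if it sends analytic fields on every open set to analytic ones
there (equivalently, its Christoffel symbols in every chart are analytic). -/
def IsAnalyticConnection
    (cov : CovariantDerivative 𝓘(ℝ, E) E (TangentSpace 𝓘(ℝ, E) : Q → Type _)) : Prop :=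
  ∀ u : Set Q, IsOpen u → ContMDiffCovariantDerivativeOn E ω cov.toFun u

variable (cov : CovariantDerivative 𝓘(ℝ, E) E (TangentSpace 𝓘(ℝ, E) : Q → Type _))

/-- The symmetric product `⟨X : Y⟩ = ∇_X Y + ∇_Y X`. -/
def symProd (X Y : VField 𝓘(ℝ, E) Q) : VField 𝓘(ℝ, E) Q :=
  fun q ↦ cov Y q (X q) + cov X q (Y q)

/-- The symmetric closure `Sym^(∞)(S)`: the smallest real subspace of vector fields that contains
`S` and is closed under the symmetric product. -/
def symClosure (S : Set (VField 𝓘(ℝ, E) Q)) : Submodule ℝ (VField 𝓘(ℝ, E) Q) :=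
  sInf {W | S ⊆ W ∧ ∀ X ∈ W, ∀ Y ∈ W, symProd cov X Y ∈ W}

/-- The geodesic spray: `Z(v) = T_q X (v) - vlft_v (∇_v X)` for any vector field `X` that is
differentiable at `q` with `X(q) = v`. This is the horizontal lift of `v` at `v`; it does not
depend on `X`, and in coordinates it is `v^i ∂/∂q^i - Γ^i_{jk} v^j v^k ∂/∂v^i`. Here `X` is the
extension of `v` that is constant in the preferred chart at `q`; since `X(q) = v`, the vector
`T_q X (v)` is tangent to `TQ` at `v`. -/
def geodesicSpray : VField 𝓘(ℝ, E).tangent (TangentBundle 𝓘(ℝ, E) Q) :=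
  fun v ↦
    let X : VField 𝓘(ℝ, E) Q := FiberBundle.extend E v.snd
    let TXv : TangentSpace 𝓘(ℝ, E).tangent v :=
      mfderiv 𝓘(ℝ, E) 𝓘(ℝ, E).tangent
        (fun q ↦ (⟨q, X q⟩ : TangentBundle 𝓘(ℝ, E) Q)) v.proj v.snd
    TXv - vlft v (cov X v.proj v.snd)

/-- `ad_Z^l W`, the `l`-fold bracket `[Z,[Z,…,[Z,W]…]]` with the geodesic spray `Z`. -/
def adSpray (l : ℕ) (W : VField 𝓘(ℝ, E).tangent (TangentBundle 𝓘(ℝ, E) Q)) :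
    VField 𝓘(ℝ, E).tangent (TangentBundle 𝓘(ℝ, E) Q) :=
  (VectorField.mlieBracket 𝓘(ℝ, E).tangent (geodesicSpray cov))^[l] W

/-- `Lie^(∞)(Z, S^V)`, where `Z` is the geodesic spray. -/
def accessibilityAlgebra (S : Set (VField 𝓘(ℝ, E) Q)) :
    Submodule ℝ (VField 𝓘(ℝ, E).tangent (TangentBundle 𝓘(ℝ, E) Q)) :=
  lieClosure 𝓘(ℝ, E).tangent (insert (geodesicSpray cov) (verticalLift '' S))

/-- The vertical lifts of the elements of `Sym^(∞)(S)`. -/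
def familyA (S : Set (VField 𝓘(ℝ, E) Q)) :
    Submodule ℝ (VField 𝓘(ℝ, E).tangent (TangentBundle 𝓘(ℝ, E) Q)) :=
  Submodule.span ℝ {W | ∃ X ∈ symClosure cov S, W = verticalLift X}

/-- The span of the fields `ad_Z^l (X^V)` with `l ≥ 0` and `X ∈ Sym^(∞)(S)`. -/
def familyB (S : Set (VField 𝓘(ℝ, E) Q)) :
    Submodule ℝ (VField 𝓘(ℝ, E).tangent (TangentBundle 𝓘(ℝ, E) Q)) :=
  Submodule.span ℝ
    {W | ∃ l : ℕ, ∃ X ∈ symClosure cov S, W = adSpray cov l (verticalLift X)}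

/-- The involutive closure of the fields `ad_Z^l (X^V)` with `l ≥ 1` and `X ∈ Sym^(∞)(S)`. -/
def familyC (S : Set (VField 𝓘(ℝ, E) Q)) :
    Submodule ℝ (VField 𝓘(ℝ, E).tangent (TangentBundle 𝓘(ℝ, E) Q)) :=
  lieClosure 𝓘(ℝ, E).tangent
    {W | ∃ l : ℕ, 1 ≤ l ∧ ∃ X ∈ symClosure cov S, W = adSpray cov l (verticalLift X)}

end Connection

end AffineControl

end

/-!
Write `Z` for the geodesic spray and `A`, `B`, `C` for the three families. The equality holds as
one of spaces of vector fields, `Lie(Z, Y^V) = ℝ Z + A + B + C`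
(`accessibilityAlgebra_eq_sup`), and evaluation at a point is linear.

Two bracket identities on `TQ` carry the proof: vertical lifts commute, and
`[X^V, [Z, Y^V]] = ⟨X : Y⟩^V`. Both are checked in the chart `(x, u)` of `TQ`, where
`X^V = (0, X)`, `Z = (u, -Γ(u, u))` and hence `[Z, Y^V] = (-Y, DY(u) + Γ(u, Y) + Γ(Y, u))`
(`chartRep_verticalLift`, `chartRep_geodesicSpray`, `lieBracket_flatSpray`,
`lieBracket_flatBracket`). The spray is expressed in a fixed chart through Christoffel symbols,
which are analytic because the connection maps analytic local fields to analytic ones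
(`exists_hasChristoffel`).

The second identity puts the vertical lifts of the symmetric closure into the Lie algebra, which
gives one inclusion. For the other it is enough that the part `ℝ Z + A + C` of the right-hand side
is closed under the bracket. The derivation `ad_Z` maps `A + C` into `C`; `[A, A] = 0`; `C` is
closed by definition; and `[A, C] ⊆ A + C` follows from `[X^V, ad_Z^l Y^V] ∈ A + C`, an induction
on `l` with the Jacobi identity, because the elements of `C` that satisfy such an inclusion form a
Lie subalgebra.

The Jacobi identity and the bilinearity of the bracket need differentiability, so all fields are
kept inside the space of `C^∞` fields on `TQ`. On `Q` analyticity has to be tracked instead, since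
the regularity of the connection is only stated for analytic fields.
-/

noncomputable section
namespace AffineControl

open Set Filter Topology VectorField Bundle

/-! ### Vector fields in a chart -/

section ChartRep

variable {F K : Type*} [NormedAddCommGroup F] [NormedSpace ℝ F] [TopologicalSpace K]
  {J : ModelWithCorners ℝ F K} {M : Type*} [TopologicalSpace M] [ChartedSpace K M]

/-- A vector field of class `C^∞`. -/
def IsSmoothField [IsManifold J ω M] (V : VField J M) : Prop :=
  ContMDiff J J.tangent ∞ (fun p ↦ (⟨p, V p⟩ : TangentBundle J M))

/-- The expression of a vector field in the preferred chart at `x₀`, a vector field on the model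
space; it is meaningful on the target of that chart. -/
def chartRep (x₀ : M) (V : VField J M) : F → F :=
  mpullback 𝓘(ℝ, F) J (extChartAt J x₀).symm V

variable [IsManifold J ω M]

lemma isManifold_minSmoothness (n : ℕ∞ω) : IsManifold J (minSmoothness ℝ n) M :=
  IsManifold.of_le (n := ω) le_top

variable {x₀ : M} {V W : VField J M} {p : F}

lemma IsSmoothField.mdifferentiableAt (hV : IsSmoothField V) (x : M) :
    MDifferentiableAt J J.tangent (fun p ↦ (⟨p, V p⟩ : TangentBundle J M)) x :=
  (hV x).mdifferentiableAt (by simp)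

lemma IsSmoothField.mlieBracket [CompleteSpace F] (hV : IsSmoothField V) (hW : IsSmoothField W) :
    IsSmoothField (mlieBracket J V W) := by
  have : IsManifold J (((⊤ : ℕ∞) : ℕ∞ω) + 1) M := IsManifold.of_le (n := ω) le_top
  exact ContDiff.mlieBracket_vectorField (m := ⊤) (n := ⊤) hV hW (by simp)

variable [J.Boundaryless]

lemma contMDiffAt_extChartAt_symm (hp : p ∈ (extChartAt J x₀).target) (n : ℕ∞ω) :
    ContMDiffAt 𝓘(ℝ, F) J n (extChartAt J x₀).symm p :=
  have : IsManifold J n M := IsManifold.of_le (n := ω) le_top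
  (contMDiffOn_extChartAt_symm x₀).contMDiffAt ((isOpen_extChartAt_target x₀).mem_nhds hp)

lemma isInvertible_mfderiv_extChartAt_symm (hp : p ∈ (extChartAt J x₀).target) :
    (mfderiv 𝓘(ℝ, F) J (extChartAt J x₀).symm p).IsInvertible := by
  have := isInvertible_mfderivWithin_extChartAt_symm (I := J) hp
  rwa [J.range_eq_univ, mfderivWithin_univ] at this

lemma chartRep_eq (hp : p ∈ (extChartAt J x₀).target) {w : F}
    (h : V ((extChartAt J x₀).symm p) = mfderiv 𝓘(ℝ, F) J (extChartAt J x₀).symm p w) :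
    chartRep x₀ V p = w := by
  rw [chartRep, mpullback_apply, h]
  exact (isInvertible_mfderiv_extChartAt_symm hp).inverse_apply_self w

/-- A field is determined at a point by its expression in any chart around it. -/
lemma eq_of_chartRep_eq
    (h : chartRep x₀ V (extChartAt J x₀ x₀) = chartRep x₀ W (extChartAt J x₀ x₀)) :
    V x₀ = W x₀ := by
  have hp := mem_extChartAt_target (I := J) x₀
  simp only [chartRep, mpullback_apply] at h
  obtain ⟨e, he⟩ := isInvertible_mfderiv_extChartAt_symm hp
  rw [← he, ContinuousLinearMap.inverse_equiv] at h
  have := e.symm.injective h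
  rwa [extChartAt_to_inv] at this

lemma contMDiffAt_of_chartRep [CompleteSpace F]
    (h : ContDiffAt ℝ ∞ (chartRep x₀ V) (extChartAt J x₀ x₀)) :
    ContMDiffAt J J.tangent ∞ (fun p ↦ (⟨p, V p⟩ : TangentBundle J M)) x₀ := by
  replace h := contMDiffAt_vectorSpace_iff_contDiffAt.2 h
  have key := ContMDiffAt.mpullback_vectorField_preimage (n := ω) h
    (contMDiffAt_extChartAt (I := J) (n := ω) (x := x₀))
    (isInvertible_mfderiv_extChartAt (mem_extChartAt_source x₀)) le_top
  refine key.congr_of_eventuallyEq ?_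
  have := eventuallyEq_mpullback_mpullbackWithin_extChartAt (I := J) (x := x₀) (s := univ) V
  rw [nhdsWithin_univ, J.range_eq_univ, mpullbackWithin_univ] at this
  filter_upwards [this] with y hy
  exact congrArg (fun w ↦ (⟨y, w⟩ : TangentBundle J M)) hy

/-- The bracket of vector fields is computed in a single chart, at every point of its target. -/
lemma chartRep_mlieBracket [CompleteSpace F] (hV : IsSmoothField V) (hW : IsSmoothField W)
    (hp : p ∈ (extChartAt J x₀).target) :
    chartRep x₀ (mlieBracket J V W) p =
      lieBracket ℝ (chartRep x₀ V) (chartRep x₀ W) p := by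
  have := isManifold_minSmoothness (J := J) (M := M) 2
  rw [chartRep, mpullback_mlieBracket (n := ω) (hV.mdifferentiableAt _) (hW.mdifferentiableAt _)
    (contMDiffAt_extChartAt_symm hp ω) le_top, ← mlieBracketWithin_univ,
    mlieBracketWithin_eq_lieBracketWithin]
  exact congrFun lieBracketWithin_univ p

end ChartRep

/-! ### The tangent bundle in a chart -/

section TangentChart
variable {E : Type*} [NormedAddCommGroup E] [NormedSpace ℝ E]
  {Q : Type*} [TopologicalSpace Q] [ChartedSpace E Q]

lemma symm_mem_source {q₀ : Q} {x : E} (hx : x ∈ (extChartAt 𝓘(ℝ, E) q₀).target) :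
    (extChartAt 𝓘(ℝ, E) q₀).symm x ∈ (chartAt E q₀).source := by
  rw [← extChartAt_source 𝓘(ℝ, E)]
  exact (extChartAt 𝓘(ℝ, E) q₀).map_target hx

variable [IsManifold 𝓘(ℝ, E) ω Q]

variable (E) in
/-- The linear map `T_q Q → E` given by the trivialization over the preferred chart at `q₀`. -/
def toCoord (q₀ q : Q) : TangentSpace 𝓘(ℝ, E) q →L[ℝ] E :=
  (trivializationAt E (TangentSpace 𝓘(ℝ, E) : Q → Type _) q₀).continuousLinearMapAt ℝ q

variable (E) in
/-- The inverse `E → T_q Q` of `toCoord E q₀ q`. -/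
def ofCoord (q₀ q : Q) : E →L[ℝ] TangentSpace 𝓘(ℝ, E) q :=
  (trivializationAt E (TangentSpace 𝓘(ℝ, E) : Q → Type _) q₀).symmL ℝ q

/-- The expression `E → E` of a vector field on `Q` in the preferred chart at `q₀`. -/
def sectionRep (q₀ : Q) (X : VField 𝓘(ℝ, E) Q) (x : E) : E :=
  toCoord E q₀ ((extChartAt 𝓘(ℝ, E) q₀).symm x) (X ((extChartAt 𝓘(ℝ, E) q₀).symm x))

variable {q₀ q : Q} {x : E}

lemma toCoord_ofCoord (hq : q ∈ (chartAt E q₀).source) (u : E) :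
    toCoord E q₀ q (ofCoord E q₀ q u) = u :=
  (trivializationAt E (TangentSpace 𝓘(ℝ, E) : Q → Type _) q₀).continuousLinearMapAt_symmL
    (b := q) hq u

lemma ofCoord_toCoord (hq : q ∈ (chartAt E q₀).source) (u : TangentSpace 𝓘(ℝ, E) q) :
    ofCoord E q₀ q (toCoord E q₀ q u) = u :=
  (trivializationAt E (TangentSpace 𝓘(ℝ, E) : Q → Type _) q₀).symmL_continuousLinearMapAt
    (b := q) hq u

lemma toCoord_eq_mfderiv (hq : q ∈ (chartAt E q₀).source) :
    toCoord E q₀ q = mfderiv 𝓘(ℝ, E) 𝓘(ℝ, E) (extChartAt 𝓘(ℝ, E) q₀) q :=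
  TangentBundle.continuousLinearMapAt_trivializationAt hq

lemma toCoord_apply (hq : q ∈ (chartAt E q₀).source) (u : TangentSpace 𝓘(ℝ, E) q) :
    toCoord E q₀ q u =
      (trivializationAt E (TangentSpace 𝓘(ℝ, E) : Q → Type _) q₀ ⟨q, u⟩).2 :=
  Trivialization.continuousLinearMapAt_apply_of_mem ℝ
    (trivializationAt E (TangentSpace 𝓘(ℝ, E) : Q → Type _) q₀) (b := q) hq u

lemma tangent_extChartAt_target (v₀ : TangentBundle 𝓘(ℝ, E) Q) :
    (extChartAt 𝓘(ℝ, E).tangent v₀).target = (extChartAt 𝓘(ℝ, E) v₀.proj).target ×ˢ univ := by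
  rw [FiberBundle.extChartAt_target, inter_eq_left.2]
  intro x hx
  exact symm_mem_source hx

lemma tangent_extChartAt_apply (v₀ v : TangentBundle 𝓘(ℝ, E) Q)
    (hv : v.proj ∈ (chartAt E v₀.proj).source) :
    extChartAt 𝓘(ℝ, E).tangent v₀ v =
      (extChartAt 𝓘(ℝ, E) v₀.proj v.proj, toCoord E v₀.proj v.proj v.snd) := by
  rw [FiberBundle.extChartAt]
  refine Prod.ext rfl ?_
  exact (toCoord_apply hv _).symm

/-- The chart of `TQ` at `v₀` has coordinates `(x, u)`, the chart coordinate of the base point and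
the components of the tangent vector. -/
lemma tangent_extChartAt_symm_eq (v₀ : TangentBundle 𝓘(ℝ, E) Q)
    (hq : q ∈ (chartAt E v₀.proj).source) (z : TangentSpace 𝓘(ℝ, E) q) :
    (extChartAt 𝓘(ℝ, E).tangent v₀).symm
      (extChartAt 𝓘(ℝ, E) v₀.proj q, toCoord E v₀.proj q z) = ⟨q, z⟩ := by
  rw [← tangent_extChartAt_apply v₀ ⟨q, z⟩ hq]
  exact (extChartAt 𝓘(ℝ, E).tangent v₀).left_inv
    (by rw [extChartAt_source]; exact (TangentBundle.mem_chart_source_iff _ _).2 hq)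

lemma mem_tangent_target (v₀ : TangentBundle 𝓘(ℝ, E) Q)
    (hq : q ∈ (chartAt E v₀.proj).source) (u : E) :
    (extChartAt 𝓘(ℝ, E) v₀.proj q, u) ∈ (extChartAt 𝓘(ℝ, E).tangent v₀).target := by
  rw [tangent_extChartAt_target]
  exact ⟨(extChartAt 𝓘(ℝ, E) v₀.proj).map_source (by rwa [extChartAt_source]), mem_univ _⟩

lemma hasMFDerivAt_tangent_symm (v₀ : TangentBundle 𝓘(ℝ, E) Q)
    (hq : q ∈ (chartAt E v₀.proj).source) (u : E) :
    HasMFDerivAt 𝓘(ℝ, E × E) 𝓘(ℝ, E).tangent (extChartAt 𝓘(ℝ, E).tangent v₀).symm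
      (extChartAt 𝓘(ℝ, E) v₀.proj q, u)
      (mfderiv 𝓘(ℝ, E × E) 𝓘(ℝ, E).tangent (extChartAt 𝓘(ℝ, E).tangent v₀).symm
        (extChartAt 𝓘(ℝ, E) v₀.proj q, u)) :=
  ((contMDiffAt_extChartAt_symm (mem_tangent_target v₀ hq u) 1).mdifferentiableAt
    one_ne_zero).hasMFDerivAt

/-- In the chart of `TQ` the vertical lift of `w` is `(0, w)`. -/
lemma vlft_eq (v₀ : TangentBundle 𝓘(ℝ, E) Q) (hq : q ∈ (chartAt E v₀.proj).source)
    (z : E) (w : TangentSpace 𝓘(ℝ, E) q) :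
    (vlft (⟨q, z⟩ : TangentBundle 𝓘(ℝ, E) Q) w : E × E) =
      mfderiv 𝓘(ℝ, E × E) 𝓘(ℝ, E).tangent (extChartAt 𝓘(ℝ, E).tangent v₀).symm
        (extChartAt 𝓘(ℝ, E) v₀.proj q, toCoord E v₀.proj q (z : TangentSpace 𝓘(ℝ, E) q))
        ((0, toCoord E v₀.proj q w) : E × E) := by
  let T : E →L[ℝ] E := toCoord E v₀.proj q
  have h1 : HasFDerivAt (fun z : E ↦ (extChartAt 𝓘(ℝ, E) v₀.proj q, T z))
      ((0 : E →L[ℝ] E).prod T) (z : E) :=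
    (hasFDerivAt_const _ _).prodMk T.hasFDerivAt
  have h2 := (hasMFDerivAt_tangent_symm v₀ hq (T z)).comp (z : E) h1.hasMFDerivAt
  have h3 : (fibreInclusion q : E → TangentBundle 𝓘(ℝ, E) Q) =
      (extChartAt 𝓘(ℝ, E).tangent v₀).symm ∘
        (fun z : E ↦ (extChartAt 𝓘(ℝ, E) v₀.proj q, T z)) := by
    funext z
    exact (tangent_extChartAt_symm_eq v₀ hq z).symm
  have h4 := congrArg (fun L : E →L[ℝ] E × E ↦ L w)
    (h2.congr_of_eventuallyEq (.of_eq h3)).mfderiv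
  exact h4

lemma sectionRep_extChartAt (hq : q ∈ (chartAt E q₀).source) (X : VField 𝓘(ℝ, E) Q) :
    sectionRep q₀ X (extChartAt 𝓘(ℝ, E) q₀ q) = toCoord E q₀ q (X q) := by
  rw [sectionRep, (extChartAt 𝓘(ℝ, E) q₀).left_inv (by rwa [extChartAt_source])]

lemma differentiableAt_sectionRep {X : VField 𝓘(ℝ, E) Q}
    (hq : q ∈ (chartAt E q₀).source)
    (hX : MDifferentiableAt 𝓘(ℝ, E) 𝓘(ℝ, E).tangent
      (fun q ↦ (⟨q, X q⟩ : TangentBundle 𝓘(ℝ, E) Q)) q) :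
    DifferentiableAt ℝ (sectionRep q₀ X) (extChartAt 𝓘(ℝ, E) q₀ q) := by
  have hx : extChartAt 𝓘(ℝ, E) q₀ q ∈ (extChartAt 𝓘(ℝ, E) q₀).target :=
    (extChartAt 𝓘(ℝ, E) q₀).map_source (by rwa [extChartAt_source])
  have hxq : (extChartAt 𝓘(ℝ, E) q₀).symm (extChartAt 𝓘(ℝ, E) q₀ q) = q :=
    (extChartAt 𝓘(ℝ, E) q₀).left_inv (by rwa [extChartAt_source])
  have h1 := (Trivialization.mdifferentiableAt_section_iff 𝓘(ℝ, E)
    (e := trivializationAt E (TangentSpace 𝓘(ℝ, E) : Q → Type _) q₀) X (b₀ := q) hq).1 hX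
  rw [← mdifferentiableAt_iff_differentiableAt]
  rw [← hxq] at h1
  have h2 := h1.comp _
    ((contMDiffAt_extChartAt_symm hx 1).mdifferentiableAt one_ne_zero)
  refine h2.congr_of_eventuallyEq ?_
  filter_upwards [(isOpen_extChartAt_target q₀).mem_nhds hx] with y hy
  exact toCoord_apply (symm_mem_source hy) _

/-- In the chart of `TQ` the tangent map of a section `X` sends `z` to `(z, DX(z))`. -/
lemma mfderiv_section_eq (v₀ : TangentBundle 𝓘(ℝ, E) Q) {X : VField 𝓘(ℝ, E) Q}
    (hq : q ∈ (chartAt E v₀.proj).source)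
    (hX : MDifferentiableAt 𝓘(ℝ, E) 𝓘(ℝ, E).tangent
      (fun q ↦ (⟨q, X q⟩ : TangentBundle 𝓘(ℝ, E) Q)) q) (z : TangentSpace 𝓘(ℝ, E) q) :
    (mfderiv 𝓘(ℝ, E) 𝓘(ℝ, E).tangent
        (fun q ↦ (⟨q, X q⟩ : TangentBundle 𝓘(ℝ, E) Q)) q z : E × E) =
      mfderiv 𝓘(ℝ, E × E) 𝓘(ℝ, E).tangent (extChartAt 𝓘(ℝ, E).tangent v₀).symm
        (extChartAt 𝓘(ℝ, E) v₀.proj q, toCoord E v₀.proj q (X q))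
        ((toCoord E v₀.proj q z, fderiv ℝ (sectionRep v₀.proj X) (extChartAt 𝓘(ℝ, E) v₀.proj q)
          (toCoord E v₀.proj q z)) : E × E) := by
  set x := extChartAt 𝓘(ℝ, E) v₀.proj q
  have hrep : sectionRep v₀.proj X x = toCoord E v₀.proj q (X q) := sectionRep_extChartAt hq X
  have h1 : HasFDerivAt (fun y ↦ (y, sectionRep v₀.proj X y))
      ((ContinuousLinearMap.id ℝ E).prod (fderiv ℝ (sectionRep v₀.proj X) x)) x :=
    (hasFDerivAt_id x).prodMk (differentiableAt_sectionRep hq hX).hasFDerivAt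
  have h2 := hasMFDerivAt_tangent_symm v₀ hq (toCoord E v₀.proj q (X q))
  rw [← hrep] at h2
  have h0 : HasMFDerivAt 𝓘(ℝ, E) 𝓘(ℝ, E) (extChartAt 𝓘(ℝ, E) v₀.proj) q
      (toCoord E v₀.proj q) := by
    rw [toCoord_eq_mfderiv hq]
    exact (mdifferentiableAt_extChartAt hq).hasMFDerivAt
  have h3 := (h2.comp x h1.hasMFDerivAt).comp q h0
  have h4 := h3.congr_of_eventuallyEq (f₁ := fun q ↦ (⟨q, X q⟩ : TangentBundle 𝓘(ℝ, E) Q)) ?_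
  · have h5 := congrArg (fun L : E →L[ℝ] E × E ↦ L z) h4.mfderiv
    rw [← hrep]
    exact h5
  · filter_upwards [(chartAt E v₀.proj).open_source.mem_nhds hq] with p hp
    refine (tangent_extChartAt_symm_eq v₀ hp (X p)).symm.trans ?_
    rw [← sectionRep_extChartAt hp]
    rfl

lemma contDiffOn_sectionRep_of_contMDiffOn {X : VField 𝓘(ℝ, E) Q} {n : ℕ∞ω}
    (hX : ContMDiffOn 𝓘(ℝ, E) 𝓘(ℝ, E).tangent n
      (fun q ↦ (⟨q, X q⟩ : TangentBundle 𝓘(ℝ, E) Q)) (chartAt E q₀).source) :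
    ContDiffOn ℝ n (sectionRep q₀ X) (extChartAt 𝓘(ℝ, E) q₀).target := by
  have : IsManifold 𝓘(ℝ, E) (n + 1) Q := IsManifold.of_le (n := ω) le_top
  have : IsManifold 𝓘(ℝ, E) n Q := IsManifold.of_le (n := ω) le_top
  have : ContMDiffVectorBundle n E (TangentSpace 𝓘(ℝ, E) : Q → Type _) 𝓘(ℝ, E) :=
    TangentBundle.contMDiffVectorBundle
  have h1 := ((trivializationAt E (TangentSpace 𝓘(ℝ, E) : Q → Type _)
    q₀).contMDiffOn_section_baseSet_iff (IB := 𝓘(ℝ, E)) (n := n) (s := X)).1 hX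
  rw [← contMDiffOn_iff_contDiffOn]
  refine (h1.comp (contMDiffOn_extChartAt_symm (n := n) q₀)
    (fun y hy ↦ symm_mem_source hy)).congr ?_
  intro y hy
  exact toCoord_apply (symm_mem_source hy) _

end TangentChart

/-! ### Christoffel symbols -/

section Christoffel
variable {E : Type*} [NormedAddCommGroup E] [NormedSpace ℝ E]
  {Q : Type*} [TopologicalSpace Q] [ChartedSpace E Q] [IsManifold 𝓘(ℝ, E) ω Q]
  {cov : CovariantDerivative 𝓘(ℝ, E) E (TangentSpace 𝓘(ℝ, E) : Q → Type _)}

/-- In the preferred chart at `q₀` the connection is `∇_w X = DX(w) + G(w, X)`, where the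
bilinear-map-valued function `G` on the chart collects the Christoffel symbols. -/
def HasChristoffel (cov : CovariantDerivative 𝓘(ℝ, E) E (TangentSpace 𝓘(ℝ, E) : Q → Type _))
    (q₀ : Q) (G : E → E →L[ℝ] E →L[ℝ] E) : Prop :=
  ∀ q ∈ (chartAt E q₀).source, ∀ X : VField 𝓘(ℝ, E) Q,
    MDifferentiableAt 𝓘(ℝ, E) 𝓘(ℝ, E).tangent
      (fun q ↦ (⟨q, X q⟩ : TangentBundle 𝓘(ℝ, E) Q)) q → ∀ w : TangentSpace 𝓘(ℝ, E) q,
    toCoord E q₀ q (cov X q w) =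
      fderiv ℝ (sectionRep q₀ X) (extChartAt 𝓘(ℝ, E) q₀ q) (toCoord E q₀ q w) +
      G (extChartAt 𝓘(ℝ, E) q₀ q) (toCoord E q₀ q w) (toCoord E q₀ q (X q))

/-- The vector field that is constant, equal to `u`, in the preferred chart at `q₀`. -/
def constField (q₀ : Q) (u : E) : VField 𝓘(ℝ, E) Q := fun q ↦ ofCoord E q₀ q u

lemma contMDiffOn_constField (q₀ : Q) (u : E) (n : ℕ∞ω) :
    ContMDiffOn 𝓘(ℝ, E) 𝓘(ℝ, E).tangent n
      (fun q ↦ (⟨q, constField q₀ u q⟩ : TangentBundle 𝓘(ℝ, E) Q)) (chartAt E q₀).source := by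
  have : IsManifold 𝓘(ℝ, E) (n + 1) Q := IsManifold.of_le (n := ω) le_top
  have : IsManifold 𝓘(ℝ, E) n Q := IsManifold.of_le (n := ω) le_top
  have : ContMDiffVectorBundle n E (TangentSpace 𝓘(ℝ, E) : Q → Type _) 𝓘(ℝ, E) :=
    TangentBundle.contMDiffVectorBundle
  refine ((trivializationAt E (TangentSpace 𝓘(ℝ, E) : Q → Type _)
    q₀).contMDiffOn_section_baseSet_iff (IB := 𝓘(ℝ, E)) (n := n)).2 ?_
  refine (contMDiffOn_const (c := u)).congr fun q hq ↦ ?_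
  rw [← toCoord_apply hq]
  exact toCoord_ofCoord hq u

lemma cov_sum {ι : Type*} (t : Finset ι) {σ : ι → VField 𝓘(ℝ, E) Q} {q : Q}
    (hσ : ∀ i, MDifferentiableAt 𝓘(ℝ, E) 𝓘(ℝ, E).tangent
      (fun q ↦ (⟨q, σ i q⟩ : TangentBundle 𝓘(ℝ, E) Q)) q) :
    cov (fun p ↦ ∑ i ∈ t, σ i p) q = ∑ i ∈ t, cov (σ i) q := by
  classical
  induction t using Finset.induction_on with
  | empty =>
    simp only [Finset.sum_empty]
    exact congrFun cov.zero q
  | insert i t hi ih =>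
    rw [Finset.sum_insert hi, ← ih]
    have h := cov.isCovariantDerivativeOnUniv.add (hσ i)
      (MDifferentiableAt.sum_section (s := t) (t := σ) (fun i _ ↦ hσ i)) (mem_univ q)
    rw [← h]
    congr 1
    funext p
    simp [Finset.sum_insert hi]

/-- The covariant derivative of an analytic field along an analytic field is analytic. -/
lemma contMDiffOn_cov_apply (hcov : IsAnalyticConnection cov) {u : Set Q} (hu : IsOpen u)
    {X Y : VField 𝓘(ℝ, E) Q}
    (hX : ContMDiffOn 𝓘(ℝ, E) 𝓘(ℝ, E).tangent ω
      (fun q ↦ (⟨q, X q⟩ : TangentBundle 𝓘(ℝ, E) Q)) u)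
    (hY : ContMDiffOn 𝓘(ℝ, E) 𝓘(ℝ, E).tangent ω
      (fun q ↦ (⟨q, Y q⟩ : TangentBundle 𝓘(ℝ, E) Q)) u) :
    ContMDiffOn 𝓘(ℝ, E) 𝓘(ℝ, E).tangent ω
      (fun q ↦ (⟨q, cov Y q (X q)⟩ : TangentBundle 𝓘(ℝ, E) Q)) u :=
  ContMDiffOn.clm_bundle_apply (b := fun q ↦ q) ((hcov u hu).contMDiff hY) hX

variable [FiniteDimensional ℝ E]

/-- Near `q` a field is the combination of the coordinate fields with its coordinate functions;
the Leibniz rule then expresses its covariant derivative through those of the coordinate fields. -/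
lemma cov_eq_add_sum {q₀ q : Q} (hq : q ∈ (chartAt E q₀).source) {X : VField 𝓘(ℝ, E) Q}
    (hX : MDifferentiableAt 𝓘(ℝ, E) 𝓘(ℝ, E).tangent
      (fun q ↦ (⟨q, X q⟩ : TangentBundle 𝓘(ℝ, E) Q)) q) (w : TangentSpace 𝓘(ℝ, E) q)
    {ι : Type*} [Fintype ι] (b : Module.Basis ι ℝ E) :
    toCoord E q₀ q (cov X q w) =
      fderiv ℝ (sectionRep q₀ X) (extChartAt 𝓘(ℝ, E) q₀ q) (toCoord E q₀ q w) +
      ∑ i, b.coord i (toCoord E q₀ q (X q)) •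
        toCoord E q₀ q (cov (constField q₀ (b i)) q w) := by
  set φ := extChartAt 𝓘(ℝ, E) q₀
  let c : ι → E →L[ℝ] ℝ := fun i ↦ (b.coord i).toContinuousLinearMap
  let f : ι → Q → ℝ := fun i p ↦ c i (sectionRep q₀ X (φ p))
  have hd := differentiableAt_sectionRep hq hX
  have hφd : HasMFDerivAt 𝓘(ℝ, E) 𝓘(ℝ, E) φ q (toCoord E q₀ q) := by
    rw [toCoord_eq_mfderiv hq]
    exact (mdifferentiableAt_extChartAt hq).hasMFDerivAt
  have hrep : ∀ p ∈ (chartAt E q₀).source, sectionRep q₀ X (φ p) = toCoord E q₀ p (X p) :=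
    fun p hp ↦ sectionRep_extChartAt hp X
  have hf : ∀ i, HasMFDerivAt 𝓘(ℝ, E) 𝓘(ℝ, ℝ) (f i) q
      (((c i).comp (fderiv ℝ (sectionRep q₀ X) (φ q))).comp (toCoord E q₀ q)) := fun i ↦
    ((c i).hasFDerivAt.comp (φ q) hd.hasFDerivAt).hasMFDerivAt.comp q hφd
  have hs : ∀ i, MDifferentiableAt 𝓘(ℝ, E) 𝓘(ℝ, E).tangent
      (fun p ↦ (⟨p, constField q₀ (b i) p⟩ : TangentBundle 𝓘(ℝ, E) Q)) q := fun i ↦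
    ((contMDiffOn_constField q₀ (b i) 1).contMDiffAt
      ((chartAt E q₀).open_source.mem_nhds hq)).mdifferentiableAt one_ne_zero
  have hfs : ∀ i, MDifferentiableAt 𝓘(ℝ, E) 𝓘(ℝ, E).tangent
      (fun p ↦ (⟨p, (f i • constField q₀ (b i)) p⟩ : TangentBundle 𝓘(ℝ, E) Q)) q := fun i ↦
    (hf i).mdifferentiableAt.smul_section (hs i)
  have hexp : ∀ᶠ p in 𝓝 q, X p = ∑ i, (f i • constField q₀ (b i)) p := by
    filter_upwards [(chartAt E q₀).open_source.mem_nhds hq] with p hp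
    have h1 : X p = ofCoord E q₀ p (∑ i, b.coord i (toCoord E q₀ p (X p)) • b i) := by
      simp only [Module.Basis.coord_apply]
      rw [b.sum_repr, ofCoord_toCoord hp]
    rw [h1, map_sum]
    refine Finset.sum_congr rfl fun i _ ↦ ?_
    rw [map_smul, ← hrep p hp]
    rfl
  have hcong := cov.isCovariantDerivativeOnUniv.congr_of_eventuallyEq hX
    (MDifferentiableAt.sum_section (s := Finset.univ) (fun i _ ↦ hfs i)) univ_mem hexp
  have hsum := hcong.trans (cov_sum (cov := cov) Finset.univ hfs)
  rw [hsum]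
  have hL : ∀ i, toCoord E q₀ q (cov (f i • constField q₀ (b i)) q w) =
      b.coord i (toCoord E q₀ q (X q)) • toCoord E q₀ q (cov (constField q₀ (b i)) q w) +
      b.coord i (fderiv ℝ (sectionRep q₀ X) (φ q) (toCoord E q₀ q w)) • b i := by
    intro i
    have h1 := cov.isCovariantDerivativeOnUniv.leibniz (hs i) (hf i).mdifferentiableAt (mem_univ q)
    rw [h1]
    have h2 : (mvfderiv 𝓘(ℝ, E) (f i) q) w =
        b.coord i (fderiv ℝ (sectionRep q₀ X) (φ q) (toCoord E q₀ q w)) :=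
      congrArg (fun L : E →L[ℝ] ℝ ↦ L w) (hf i).mfderiv
    rw [add_apply, map_add, smul_apply, map_smul,
      ContinuousLinearMap.smulRight_apply, map_smul, h2, ← hrep q hq]
    congr 2
    exact toCoord_ofCoord hq _
  rw [sum_apply, map_sum, Finset.sum_congr rfl fun i _ ↦ hL i,
    Finset.sum_add_distrib, add_comm]
  congr 1
  simp only [Module.Basis.coord_apply]
  exact b.sum_repr _

/-- The Christoffel symbols of an analytic connection are analytic: they are the coordinates of
the covariant derivatives of the coordinate fields along each other. -/
lemma exists_hasChristoffel (hcov : IsAnalyticConnection cov) (q₀ : Q) :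
    ∃ G, ContDiffOn ℝ ω G (extChartAt 𝓘(ℝ, E) q₀).target ∧ HasChristoffel cov q₀ G := by
  let b := Module.finBasis ℝ E
  let c : Fin (Module.finrank ℝ E) → E →L[ℝ] ℝ := fun i ↦ (b.coord i).toContinuousLinearMap
  let γ : Fin (Module.finrank ℝ E) → Fin (Module.finrank ℝ E) → E → E := fun i j ↦
    sectionRep q₀ (fun q ↦ cov (constField q₀ (b i)) q (constField q₀ (b j) q))
  have hγ : ∀ i j, ContDiffOn ℝ ω (γ i j) (extChartAt 𝓘(ℝ, E) q₀).target := fun i j ↦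
    contDiffOn_sectionRep_of_contMDiffOn (contMDiffOn_cov_apply hcov (chartAt E q₀).open_source
      (contMDiffOn_constField q₀ (b j) ω) (contMDiffOn_constField q₀ (b i) ω))
  refine ⟨fun x ↦ ∑ j, ∑ i, (c j).smulRight ((c i).smulRight (γ i j x)), ?_, ?_⟩
  · refine ContDiffOn.sum fun j _ ↦ ContDiffOn.sum fun i _ ↦ ?_
    exact contDiffOn_const.smulRight (contDiffOn_const.smulRight (hγ i j))
  · intro q hq X hX w
    rw [cov_eq_add_sum hq hX w b]
    congr 1
    have hw : w = ∑ j, c j (toCoord E q₀ q w) • constField q₀ (b j) q := by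
      conv_lhs => rw [← ofCoord_toCoord hq w, ← b.sum_repr (toCoord E q₀ q w), map_sum]
      refine Finset.sum_congr rfl fun j _ ↦ ?_
      rw [map_smul]
      rfl
    have hγq : ∀ i j, γ i j (extChartAt 𝓘(ℝ, E) q₀ q) =
        toCoord E q₀ q (cov (constField q₀ (b i)) q (constField q₀ (b j) q)) := fun i j ↦
      sectionRep_extChartAt hq _
    simp only [sum_apply, ContinuousLinearMap.smulRight_apply,
      smul_apply, hγq]
    rw [Finset.sum_comm]
    refine Finset.sum_congr rfl fun i _ ↦ ?_
    conv_lhs => rw [hw, map_sum, map_sum, Finset.smul_sum]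
    refine Finset.sum_congr rfl fun j _ ↦ ?_
    rw [map_smul, map_smul, smul_comm]
    rfl

end Christoffel

/-! ### Brackets on a product of vector spaces -/

section Flat
variable {E : Type*} [NormedAddCommGroup E] [NormedSpace ℝ E]
  {G : E → E →L[ℝ] E →L[ℝ] E} {X Y : E → E} {x : E}

/-- The vertical lift of the field `X` on the vector space `E`, as a field on `E × E`. -/
def flatVertical (X : E → E) : E × E → E × E := fun p ↦ (0, X p.1)

/-- The geodesic spray on `E × E` of the connection on `E` with Christoffel form `G`. -/
def flatSpray (G : E → E →L[ℝ] E →L[ℝ] E) : E × E → E × E := fun p ↦ (p.2, -G p.1 p.2 p.2)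

/-- The bracket of `flatSpray G` with `flatVertical Y`. -/
def flatBracket (G : E → E →L[ℝ] E →L[ℝ] E) (Y : E → E) : E × E → E × E :=
  fun p ↦ (-Y p.1, fderiv ℝ Y p.1 p.2 + G p.1 p.2 (Y p.1) + G p.1 (Y p.1) p.2)

lemma hasFDerivAt_comp_fst {F : Type*} [NormedAddCommGroup F] [NormedSpace ℝ F] {f : E → F}
    (hf : DifferentiableAt ℝ f x) (u : E) :
    HasFDerivAt (fun p : E × E ↦ f p.1) ((fderiv ℝ f x).comp (.fst ℝ E E)) (x, u) :=
  HasFDerivAt.comp (x, u) (f := Prod.fst) hf.hasFDerivAt hasFDerivAt_fst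

lemma hasFDerivAt_flatVertical (hX : DifferentiableAt ℝ X x) (u : E) :
    HasFDerivAt (flatVertical X)
      ((0 : E × E →L[ℝ] E).prod ((fderiv ℝ X x).comp (.fst ℝ E E))) (x, u) :=
  (hasFDerivAt_const _ _).prodMk
    (hasFDerivAt_comp_fst hX u)

lemma lieBracket_flatVertical (hX : DifferentiableAt ℝ X x) (hY : DifferentiableAt ℝ Y x)
    (u : E) : lieBracket ℝ (flatVertical X) (flatVertical Y) (x, u) = 0 := by
  rw [lieBracket, (hasFDerivAt_flatVertical hX u).fderiv,
    (hasFDerivAt_flatVertical hY u).fderiv]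
  simp [flatVertical]

set_option synthInstance.maxHeartbeats 200000 in
lemma lieBracket_flatSpray (hG : DifferentiableAt ℝ G x) (hY : DifferentiableAt ℝ Y x) (u : E) :
    lieBracket ℝ (flatSpray G) (flatVertical Y) (x, u) = flatBracket G Y (x, u) := by
  have h1 := hasFDerivAt_comp_fst (F := E →L[ℝ] E →L[ℝ] E) hG u
  have h2 : HasFDerivAt (fun p : E × E ↦ p.2) (.snd ℝ E E) (x, u) := hasFDerivAt_snd
  have h3 := h2.prodMk ((h1.clm_apply h2).clm_apply h2).neg
  rw [lieBracket, (hasFDerivAt_flatVertical hY u).fderiv,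
    show fderiv ℝ (flatSpray G) (x, u) = _ from h3.fderiv]
  simp [flatVertical, flatSpray, flatBracket]
  abel

set_option synthInstance.maxHeartbeats 200000 in
lemma lieBracket_flatBracket (hG : DifferentiableAt ℝ G x) (hX : DifferentiableAt ℝ X x)
    (hY : DifferentiableAt ℝ Y x) (hY' : DifferentiableAt ℝ (fderiv ℝ Y) x) (u : E) :
    lieBracket ℝ (flatVertical X) (flatBracket G Y) (x, u) =
      (0, (fderiv ℝ Y x (X x) + G x (X x) (Y x)) + (fderiv ℝ X x (Y x) + G x (Y x) (X x))) := by
  have h1 := hasFDerivAt_comp_fst (F := E →L[ℝ] E →L[ℝ] E) hG u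
  have h2 : HasFDerivAt (fun p : E × E ↦ p.2) (.snd ℝ E E) (x, u) := hasFDerivAt_snd
  have h3 : HasFDerivAt (fun p : E × E ↦ Y p.1) ((fderiv ℝ Y x).comp (.fst ℝ E E)) (x, u) :=
    HasFDerivAt.comp (x, u) (f := Prod.fst) hY.hasFDerivAt hasFDerivAt_fst
  have h4 : HasFDerivAt (fun p : E × E ↦ fderiv ℝ Y p.1)
      ((fderiv ℝ (fderiv ℝ Y) x).comp (.fst ℝ E E)) (x, u) :=
    HasFDerivAt.comp (x, u) (f := Prod.fst) hY'.hasFDerivAt hasFDerivAt_fst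
  have h5 := h3.neg.prodMk (((h4.clm_apply h2).add ((h1.clm_apply h2).clm_apply h3)).add
    ((h1.clm_apply h3).clm_apply h2))
  rw [lieBracket, (hasFDerivAt_flatVertical hX u).fderiv,
    show fderiv ℝ (flatBracket G Y) (x, u) = _ from h5.fderiv]
  simp [flatVertical, flatBracket]
  abel

end Flat

/-! ### The spray, vertical lifts and their brackets -/

section Fields
variable {E : Type*} [NormedAddCommGroup E] [NormedSpace ℝ E]
  {Q : Type*} [TopologicalSpace Q] [ChartedSpace E Q] [IsManifold 𝓘(ℝ, E) ω Q]
  {cov : CovariantDerivative 𝓘(ℝ, E) E (TangentSpace 𝓘(ℝ, E) : Q → Type _)}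

/-- The chart expression of `W` may be computed at points written as a base point `q` with a
tangent vector `z`, which avoids transport between fibres over equal base points. -/
lemma chartRep_eq_of_fibre {W : VField 𝓘(ℝ, E).tangent (TangentBundle 𝓘(ℝ, E) Q)}
    (v₀ : TangentBundle 𝓘(ℝ, E) Q) {x : E} (hx : x ∈ (extChartAt 𝓘(ℝ, E) v₀.proj).target) (u : E)
    {w : E × E}
    (h : ∀ q ∈ (chartAt E v₀.proj).source, x = extChartAt 𝓘(ℝ, E) v₀.proj q →
      ∀ z : TangentSpace 𝓘(ℝ, E) q, u = toCoord E v₀.proj q z →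
      (W ⟨q, z⟩ : E × E) = mfderiv 𝓘(ℝ, E × E) 𝓘(ℝ, E).tangent
        (extChartAt 𝓘(ℝ, E).tangent v₀).symm
        (extChartAt 𝓘(ℝ, E) v₀.proj q, toCoord E v₀.proj q z) w) :
    chartRep v₀ W (x, u) = w := by
  have hq := symm_mem_source hx
  have hxq := ((extChartAt 𝓘(ℝ, E) v₀.proj).right_inv hx).symm
  generalize hq' : (extChartAt 𝓘(ℝ, E) v₀.proj).symm x = q at hq hxq
  have hz := (toCoord_ofCoord hq u).symm
  generalize ofCoord E v₀.proj q u = z at hz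
  have h1 := h q hq hxq z hz
  rw [← hxq, ← hz] at h1
  refine chartRep_eq (by rw [hxq]; exact mem_tangent_target v₀ hq u) ?_
  have h2 : (extChartAt 𝓘(ℝ, E).tangent v₀).symm (x, u) = ⟨q, z⟩ := by
    rw [hxq, hz]
    exact tangent_extChartAt_symm_eq v₀ hq z
  exact (congrArg (fun v ↦ (W v : E × E)) h2).trans h1

lemma chartRep_verticalLift (X : VField 𝓘(ℝ, E) Q) (v₀ : TangentBundle 𝓘(ℝ, E) Q) {x : E}
    (hx : x ∈ (extChartAt 𝓘(ℝ, E) v₀.proj).target) (u : E) :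
    chartRep v₀ (verticalLift X) (x, u) = flatVertical (sectionRep v₀.proj X) (x, u) := by
  refine chartRep_eq_of_fibre v₀ hx u fun q hq hxq z hz ↦ ?_
  rw [flatVertical, hxq, sectionRep_extChartAt hq]
  exact vlft_eq v₀ hq z (X q)

/-- The coordinate formula for the geodesic spray: the derivative terms of the tangent map of the
auxiliary field and of its covariant derivative cancel. -/
lemma chartRep_geodesicSpray {v₀ : TangentBundle 𝓘(ℝ, E) Q} {G : E → E →L[ℝ] E →L[ℝ] E}
    (hG : HasChristoffel cov v₀.proj G) {x : E}
    (hx : x ∈ (extChartAt 𝓘(ℝ, E) v₀.proj).target) (u : E) :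
    chartRep v₀ (geodesicSpray cov) (x, u) = flatSpray G (x, u) := by
  refine chartRep_eq_of_fibre v₀ hx u fun q hq hxq z hz ↦ ?_
  let X : VField 𝓘(ℝ, E) Q := FiberBundle.extend E z
  have hX : MDifferentiableAt 𝓘(ℝ, E) 𝓘(ℝ, E).tangent
      (fun q ↦ (⟨q, X q⟩ : TangentBundle 𝓘(ℝ, E) Q)) q := by
    exact FiberBundle.mdifferentiableAt_extend 𝓘(ℝ, E) E z
  have hXq : X q = z := FiberBundle.extend_apply_self E z
  have h1 := mfderiv_section_eq v₀ hq hX z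
  have h2 := vlft_eq v₀ hq z (cov X q z)
  have h3 := hG q hq X hX z
  rw [hXq] at h1 h3
  rw [h3] at h2
  let A : E × E := mfderiv 𝓘(ℝ, E) 𝓘(ℝ, E).tangent
    (fun q ↦ (⟨q, X q⟩ : TangentBundle 𝓘(ℝ, E) Q)) q z
  let B : E × E := vlft (⟨q, z⟩ : TangentBundle 𝓘(ℝ, E) Q) (cov X q z)
  have h4 : (geodesicSpray cov (⟨q, z⟩ : TangentBundle 𝓘(ℝ, E) Q) : E × E) = A - B := rfl
  rw [h4, show A = _ from h1, show B = _ from h2, flatSpray, hxq, hz]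
  refine (map_sub (mfderiv 𝓘(ℝ, E × E) 𝓘(ℝ, E).tangent
        (extChartAt 𝓘(ℝ, E).tangent v₀).symm
        (extChartAt 𝓘(ℝ, E) v₀.proj q, toCoord E v₀.proj q z)) _ _).symm.trans ?_
  refine congrArg _ (Prod.ext ?_ ?_)
  · exact sub_zero _
  · exact sub_add_cancel_left _ _

lemma IsAnalyticField.contDiffOn_sectionRep {X : VField 𝓘(ℝ, E) Q} (hX : IsAnalyticField X)
    (q₀ : Q) : ContDiffOn ℝ ω (sectionRep q₀ X) (extChartAt 𝓘(ℝ, E) q₀).target :=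
  contDiffOn_sectionRep_of_contMDiffOn (ContMDiff.contMDiffOn hX)

lemma IsAnalyticField.contDiffAt_sectionRep {X : VField 𝓘(ℝ, E) Q} (hX : IsAnalyticField X)
    {q₀ : Q} {x : E} (hx : x ∈ (extChartAt 𝓘(ℝ, E) q₀).target) :
    ContDiffAt ℝ ω (sectionRep q₀ X) x :=
  (hX.contDiffOn_sectionRep q₀).contDiffAt ((isOpen_extChartAt_target q₀).mem_nhds hx)

lemma isAnalyticField_symProd (hcov : IsAnalyticConnection cov) {X Y : VField 𝓘(ℝ, E) Q}
    (hX : IsAnalyticField X) (hY : IsAnalyticField Y) : IsAnalyticField (symProd cov X Y) := by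
  have h1 := contMDiffOn_cov_apply hcov isOpen_univ (ContMDiff.contMDiffOn hX)
    (ContMDiff.contMDiffOn hY)
  have h2 := contMDiffOn_cov_apply hcov isOpen_univ (ContMDiff.contMDiffOn hY)
    (ContMDiff.contMDiffOn hX)
  exact contMDiffOn_univ.1 (h1.add_section h2)

variable [FiniteDimensional ℝ E]

lemma IsAnalyticField.isSmoothField_verticalLift {X : VField 𝓘(ℝ, E) Q} (hX : IsAnalyticField X) :
    IsSmoothField (verticalLift X) := by
  have := FiniteDimensional.complete ℝ E
  intro v₀
  refine contMDiffAt_of_chartRep ?_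
  have hx := mem_extChartAt_target (I := 𝓘(ℝ, E)) v₀.proj
  have hp := mem_extChartAt_target (I := 𝓘(ℝ, E).tangent) v₀
  have h1 : ContDiffAt ℝ ∞ (flatVertical (sectionRep v₀.proj X))
      (extChartAt 𝓘(ℝ, E).tangent v₀ v₀) :=
    contDiffAt_const.prodMk
      (ContDiffAt.comp (f := Prod.fst) (extChartAt 𝓘(ℝ, E).tangent v₀ v₀)
        ((hX.contDiffAt_sectionRep hx).of_le le_top) contDiffAt_fst)
  refine h1.congr_of_eventuallyEq ?_
  filter_upwards [(isOpen_extChartAt_target v₀).mem_nhds hp] with p hp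
  rw [tangent_extChartAt_target] at hp
  exact chartRep_verticalLift X v₀ hp.1 p.2

lemma isSmoothField_geodesicSpray (hcov : IsAnalyticConnection cov) :
    IsSmoothField (geodesicSpray cov) := by
  have := FiniteDimensional.complete ℝ E
  intro v₀
  refine contMDiffAt_of_chartRep ?_
  have hx := mem_extChartAt_target (I := 𝓘(ℝ, E)) v₀.proj
  have hp := mem_extChartAt_target (I := 𝓘(ℝ, E).tangent) v₀
  obtain ⟨G, hGs, hG⟩ := exists_hasChristoffel hcov v₀.proj
  have hGx : ContDiffAt ℝ ∞ G (extChartAt 𝓘(ℝ, E).tangent v₀ v₀).1 :=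
    (hGs.contDiffAt ((isOpen_extChartAt_target v₀.proj).mem_nhds hx)).of_le le_top
  have h1 : ContDiffAt ℝ ∞ (flatSpray G) (extChartAt 𝓘(ℝ, E).tangent v₀ v₀) :=
    contDiffAt_snd.prodMk
      ((((hGx.comp _ contDiffAt_fst).clm_apply contDiffAt_snd).clm_apply contDiffAt_snd).neg)
  refine h1.congr_of_eventuallyEq ?_
  filter_upwards [(isOpen_extChartAt_target v₀).mem_nhds hp] with p hp
  rw [tangent_extChartAt_target] at hp
  exact chartRep_geodesicSpray hG hp.1 p.2

/-- Vertical lifts commute. -/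
lemma mlieBracket_verticalLift {X Y : VField 𝓘(ℝ, E) Q} (hX : IsAnalyticField X)
    (hY : IsAnalyticField Y) :
    mlieBracket 𝓘(ℝ, E).tangent (verticalLift X) (verticalLift Y) = 0 := by
  have := FiniteDimensional.complete ℝ E
  funext v₀
  have hx := mem_extChartAt_target (I := 𝓘(ℝ, E)) v₀.proj
  have hp := mem_extChartAt_target (I := 𝓘(ℝ, E).tangent) v₀
  refine eq_of_chartRep_eq ?_
  rw [chartRep_mlieBracket hX.isSmoothField_verticalLift hY.isSmoothField_verticalLift hp]
  have hev : ∀ X : VField 𝓘(ℝ, E) Q, chartRep v₀ (verticalLift X) =ᶠ[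
      𝓝 (extChartAt 𝓘(ℝ, E).tangent v₀ v₀)] flatVertical (sectionRep v₀.proj X) := by
    intro X
    filter_upwards [(isOpen_extChartAt_target v₀).mem_nhds hp] with p hp
    rw [tangent_extChartAt_target] at hp
    exact chartRep_verticalLift X v₀ hp.1 p.2
  rw [(hev X).lieBracket_vectorField_eq (hev Y)]
  refine (lieBracket_flatVertical ((hX.contDiffAt_sectionRep hx).differentiableAt (by simp))
    ((hY.contDiffAt_sectionRep hx).differentiableAt (by simp)) _).trans ?_
  exact (congrFun mpullback_zero _).symm

/-- The symmetric product on `Q` is a Lie bracket on `TQ`: `[X^V, [Z, Y^V]] = ⟨X : Y⟩^V`. -/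
lemma mlieBracket_verticalLift_mlieBracket_spray (hcov : IsAnalyticConnection cov)
    {X Y : VField 𝓘(ℝ, E) Q} (hX : IsAnalyticField X) (hY : IsAnalyticField Y) :
    mlieBracket 𝓘(ℝ, E).tangent (verticalLift X)
      (mlieBracket 𝓘(ℝ, E).tangent (geodesicSpray cov) (verticalLift Y)) =
      verticalLift (symProd cov X Y) := by
  have := FiniteDimensional.complete ℝ E
  funext v₀
  have hx := mem_extChartAt_target (I := 𝓘(ℝ, E)) v₀.proj
  have hp := mem_extChartAt_target (I := 𝓘(ℝ, E).tangent) v₀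
  obtain ⟨G, hGs, hG⟩ := exists_hasChristoffel hcov v₀.proj
  have hZ := isSmoothField_geodesicSpray hcov
  have hXV := hX.isSmoothField_verticalLift
  have hYV := hY.isSmoothField_verticalLift
  have hGd : ∀ x ∈ (extChartAt 𝓘(ℝ, E) v₀.proj).target, DifferentiableAt ℝ G x := fun x hx ↦
    (hGs.contDiffAt ((isOpen_extChartAt_target v₀.proj).mem_nhds hx)).differentiableAt (by simp)
  have hYx := hY.contDiffAt_sectionRep hx
  have hpU := (isOpen_extChartAt_target v₀).mem_nhds hp
  have hev : ∀ X : VField 𝓘(ℝ, E) Q, ∀ p ∈ (extChartAt 𝓘(ℝ, E).tangent v₀).target,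
      chartRep v₀ (verticalLift X) =ᶠ[𝓝 p] flatVertical (sectionRep v₀.proj X) := by
    intro X p hp
    filter_upwards [(isOpen_extChartAt_target v₀).mem_nhds hp] with p hp
    rw [tangent_extChartAt_target] at hp
    exact chartRep_verticalLift X v₀ hp.1 p.2
  have hev2 : chartRep v₀ (mlieBracket 𝓘(ℝ, E).tangent (geodesicSpray cov) (verticalLift Y)) =ᶠ[
      𝓝 (extChartAt 𝓘(ℝ, E).tangent v₀ v₀)] flatBracket G (sectionRep v₀.proj Y) := by
    filter_upwards [hpU] with p hp
    have hevZ : chartRep v₀ (geodesicSpray cov) =ᶠ[𝓝 p] flatSpray G := by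
      filter_upwards [(isOpen_extChartAt_target v₀).mem_nhds hp] with p hp
      rw [tangent_extChartAt_target] at hp
      exact chartRep_geodesicSpray hG hp.1 p.2
    rw [chartRep_mlieBracket hZ hYV hp, hevZ.lieBracket_vectorField_eq (hev Y p hp)]
    rw [tangent_extChartAt_target] at hp
    exact lieBracket_flatSpray (hGd _ hp.1)
      ((hY.contDiffAt_sectionRep hp.1).differentiableAt (by simp)) p.2
  refine eq_of_chartRep_eq ?_
  rw [chartRep_mlieBracket hXV (hZ.mlieBracket hYV) hp,
    (hev X _ hp).lieBracket_vectorField_eq hev2]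
  have hfd : DifferentiableAt ℝ (fderiv ℝ (sectionRep v₀.proj Y))
      (extChartAt 𝓘(ℝ, E) v₀.proj v₀.proj) :=
    (hYx.fderiv_right (m := 1) le_top).differentiableAt one_ne_zero
  refine (lieBracket_flatBracket (hGd _ hx)
    ((hX.contDiffAt_sectionRep hx).differentiableAt (by simp))
    (hYx.differentiableAt (by simp)) hfd _).trans ?_
  refine ((chartRep_verticalLift _ v₀ hx _).trans ?_).symm
  have hq := mem_chart_source E v₀.proj
  have hd : ∀ {X : VField 𝓘(ℝ, E) Q}, IsAnalyticField X → MDifferentiableAt 𝓘(ℝ, E)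
      𝓘(ℝ, E).tangent (fun q ↦ (⟨q, X q⟩ : TangentBundle 𝓘(ℝ, E) Q)) v₀.proj := fun hX ↦
    (ContMDiff.contMDiffAt hX).mdifferentiableAt (by simp)
  rw [flatVertical, sectionRep_extChartAt hq, symProd, map_add, hG _ hq Y (hd hY),
    hG _ hq X (hd hX), sectionRep_extChartAt hq, sectionRep_extChartAt hq]

end Fields

/-! ### Spaces of vector fields closed under the bracket -/

section LieAlgebra

variable {F K : Type*} [NormedAddCommGroup F] [NormedSpace ℝ F] [TopologicalSpace K]
  {J : ModelWithCorners ℝ F K} {M : Type*} [TopologicalSpace M] [ChartedSpace K M]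

lemma subset_lieClosure (S : Set (VField J M)) : S ⊆ lieClosure J S := fun _ hX ↦
  Submodule.mem_sInf.2 fun _ hW ↦ hW.1 hX

lemma mlieBracket_mem_lieClosure {S : Set (VField J M)} {X Y : VField J M}
    (hX : X ∈ lieClosure J S) (hY : Y ∈ lieClosure J S) :
    mlieBracket J X Y ∈ lieClosure J S :=
  Submodule.mem_sInf.2 fun W hW ↦
    hW.2 X (Submodule.mem_sInf.1 hX W hW) Y (Submodule.mem_sInf.1 hY W hW)

lemma lieClosure_le {S : Set (VField J M)} {W : Submodule ℝ (VField J M)} (hS : S ⊆ W)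
    (hW : ∀ X ∈ W, ∀ Y ∈ W, mlieBracket J X Y ∈ W) : lieClosure J S ≤ W :=
  sInf_le ⟨hS, hW⟩

lemma mlieBracket_mem_symm {X Y : VField J M} {W : Submodule ℝ (VField J M)}
    (h : mlieBracket J X Y ∈ W) : mlieBracket J Y X ∈ W := by
  rw [mlieBracket_swap]
  exact neg_mem h

variable [IsManifold J ω M]

variable (J M) in
/-- The real vector space of `C^∞` vector fields. -/
def smoothFields : Submodule ℝ (VField J M) where
  carrier := {X | IsSmoothField X}
  add_mem' {X Y} hX hY := by
    have : IsManifold J ((∞ : ℕ∞ω) + 1) M := IsManifold.of_le (n := ω) le_top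
    have : IsManifold J (∞ : ℕ∞ω) M := IsManifold.of_le (n := ω) le_top
    exact ContMDiff.add_section hX hY
  zero_mem' := by
    have : IsManifold J ((∞ : ℕ∞ω) + 1) M := IsManifold.of_le (n := ω) le_top
    have : IsManifold J (∞ : ℕ∞ω) M := IsManifold.of_le (n := ω) le_top
    exact contMDiff_zeroSection ℝ (TangentSpace J : M → Type _)
  smul_mem' c X hX := by
    have : IsManifold J ((∞ : ℕ∞ω) + 1) M := IsManifold.of_le (n := ω) le_top
    have : IsManifold J (∞ : ℕ∞ω) M := IsManifold.of_le (n := ω) le_top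
    exact ContMDiff.const_smul_section hX

variable [CompleteSpace F] {X Y U : VField J M}

lemma mlieBracket_add_of_smooth (hX : X ∈ smoothFields J M) (hY : Y ∈ smoothFields J M) :
    mlieBracket J U (X + Y) = mlieBracket J U X + mlieBracket J U Y := by
  funext p
  exact mlieBracket_add_right (IsSmoothField.mdifferentiableAt hX p)
    (IsSmoothField.mdifferentiableAt hY p)

lemma add_mlieBracket_of_smooth (hX : X ∈ smoothFields J M) (hY : Y ∈ smoothFields J M) :
    mlieBracket J (X + Y) U = mlieBracket J X U + mlieBracket J Y U := by
  funext p
  exact mlieBracket_add_left (IsSmoothField.mdifferentiableAt hX p)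
    (IsSmoothField.mdifferentiableAt hY p)

lemma mlieBracket_smul_of_smooth (c : ℝ) (hX : X ∈ smoothFields J M) :
    mlieBracket J U (c • X) = c • mlieBracket J U X := by
  funext p
  exact mlieBracket_const_smul_right (IsSmoothField.mdifferentiableAt hX p)

lemma smul_mlieBracket_of_smooth (c : ℝ) (hX : X ∈ smoothFields J M) :
    mlieBracket J (c • X) U = c • mlieBracket J X U := by
  funext p
  exact mlieBracket_const_smul_left (IsSmoothField.mdifferentiableAt hX p)

lemma mlieBracket_mem_smoothFields (hX : X ∈ smoothFields J M) (hY : Y ∈ smoothFields J M) :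
    mlieBracket J X Y ∈ smoothFields J M :=
  IsSmoothField.mlieBracket hX hY

/-- The Jacobi identity, in the form that `[U, ·]` is a derivation of the bracket. -/
lemma mlieBracket_leibniz (hU : U ∈ smoothFields J M) (hX : X ∈ smoothFields J M)
    (hY : Y ∈ smoothFields J M) :
    mlieBracket J U (mlieBracket J X Y) =
      mlieBracket J (mlieBracket J U X) Y + mlieBracket J X (mlieBracket J U Y) := by
  have := isManifold_minSmoothness (J := J) (M := M) 3
  have h2 : minSmoothness ℝ 2 ≤ ∞ := by
    rw [minSmoothness_of_isRCLikeNormedField]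
    exact ENat.LEInfty.out
  exact leibniz_identity_mlieBracket (ContMDiff.of_le hU h2) (ContMDiff.of_le hX h2)
    (ContMDiff.of_le hY h2)

lemma lieClosure_le_smoothFields {S : Set (VField J M)} (hS : S ⊆ smoothFields J M) :
    lieClosure J S ≤ smoothFields J M :=
  lieClosure_le hS fun _ hX _ hY ↦ mlieBracket_mem_smoothFields hX hY

/-- The smooth fields `X` with `[U, X] ∈ W` for all `U ∈ T`. -/
def bracketComap (T : Set (VField J M)) (W : Submodule ℝ (VField J M)) :
    Submodule ℝ (VField J M) where
  carrier := {X | X ∈ smoothFields J M ∧ ∀ U ∈ T, mlieBracket J U X ∈ W}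
  add_mem' {X Y} hX hY := by
    refine ⟨add_mem hX.1 hY.1, fun U hU ↦ ?_⟩
    rw [mlieBracket_add_of_smooth hX.1 hY.1]
    exact add_mem (hX.2 U hU) (hY.2 U hU)
  zero_mem' := by
    refine ⟨zero_mem _, fun U _ ↦ ?_⟩
    rw [mlieBracket_zero_right]
    exact zero_mem _
  smul_mem' c X hX := by
    refine ⟨Submodule.smul_mem _ c hX.1, fun U hU ↦ ?_⟩
    rw [mlieBracket_smul_of_smooth c hX.1]
    exact Submodule.smul_mem _ c (hX.2 U hU)

variable {T : Set (VField J M)} {V W : Submodule ℝ (VField J M)}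

lemma mlieBracket_mem_of_mem_span (hT : T ⊆ smoothFields J M)
    (h : ∀ t ∈ T, mlieBracket J t X ∈ W) (hU : U ∈ Submodule.span ℝ T) :
    mlieBracket J U X ∈ W := by
  have hsm : Submodule.span ℝ T ≤ smoothFields J M := Submodule.span_le.2 hT
  induction hU using Submodule.span_induction with
  | mem t ht => exact h t ht
  | zero => rw [mlieBracket_zero_left]; exact zero_mem _
  | add Y Y' hY hY' ih ih' =>
    rw [add_mlieBracket_of_smooth (hsm hY) (hsm hY')]
    exact add_mem ih ih'
  | smul c Y hY ih =>
    rw [smul_mlieBracket_of_smooth c (hsm hY)]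
    exact Submodule.smul_mem _ c ih

lemma mlieBracket_mem_sup (hV : V ≤ smoothFields J M) (hW : W ≤ smoothFields J M)
    (hVV : ∀ X ∈ V, ∀ Y ∈ V, mlieBracket J X Y ∈ V ⊔ W)
    (hVW : ∀ X ∈ V, ∀ Y ∈ W, mlieBracket J X Y ∈ V ⊔ W)
    (hWW : ∀ X ∈ W, ∀ Y ∈ W, mlieBracket J X Y ∈ V ⊔ W) :
    ∀ X ∈ V ⊔ W, ∀ Y ∈ V ⊔ W, mlieBracket J X Y ∈ V ⊔ W := by
  intro X hX Y hY
  obtain ⟨a, ha, b, hb, rfl⟩ := Submodule.mem_sup.1 hX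
  obtain ⟨c, hc, d, hd, rfl⟩ := Submodule.mem_sup.1 hY
  rw [add_mlieBracket_of_smooth (hV ha) (hW hb), mlieBracket_add_of_smooth (hV hc) (hW hd),
    mlieBracket_add_of_smooth (hV hc) (hW hd)]
  exact add_mem (add_mem (hVV a ha c hc) (hVW a ha d hd))
    (add_mem (mlieBracket_mem_symm (hVW c hc b hb)) (hWW b hb d hd))

end LieAlgebra

/-! ### The accessibility algebra -/

section Accessibility

variable {E : Type*} [NormedAddCommGroup E] [NormedSpace ℝ E]
  {Q : Type*} [TopologicalSpace Q] [ChartedSpace E Q] [IsManifold 𝓘(ℝ, E) ω Q]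
  {cov : CovariantDerivative 𝓘(ℝ, E) E (TangentSpace 𝓘(ℝ, E) : Q → Type _)}
  {S : Set (VField 𝓘(ℝ, E) Q)}

lemma subset_symClosure (S : Set (VField 𝓘(ℝ, E) Q)) : S ⊆ symClosure cov S := fun _ hX ↦
  Submodule.mem_sInf.2 fun _ hW ↦ hW.1 hX

lemma symProd_mem_symClosure {X Y : VField 𝓘(ℝ, E) Q} (hX : X ∈ symClosure cov S)
    (hY : Y ∈ symClosure cov S) : symProd cov X Y ∈ symClosure cov S :=
  Submodule.mem_sInf.2 fun W hW ↦
    hW.2 X (Submodule.mem_sInf.1 hX W hW) Y (Submodule.mem_sInf.1 hY W hW)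

lemma symClosure_le {W : Submodule ℝ (VField 𝓘(ℝ, E) Q)} (hS : S ⊆ W)
    (hW : ∀ X ∈ W, ∀ Y ∈ W, symProd cov X Y ∈ W) : symClosure cov S ≤ W :=
  sInf_le ⟨hS, hW⟩

variable (E Q) in
/-- The real vector space of analytic vector fields. -/
def analyticFields : Submodule ℝ (VField 𝓘(ℝ, E) Q) where
  carrier := {X | IsAnalyticField X}
  add_mem' hX hY := ContMDiff.add_section hX hY
  zero_mem' := contMDiff_zeroSection ℝ (TangentSpace 𝓘(ℝ, E) : Q → Type _)
  smul_mem' _ _ hX := ContMDiff.const_smul_section hX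

lemma isAnalyticField_of_mem_symClosure (hcov : IsAnalyticConnection cov)
    (hS : ∀ X ∈ S, IsAnalyticField X) {X : VField 𝓘(ℝ, E) Q} (hX : X ∈ symClosure cov S) :
    IsAnalyticField X :=
  symClosure_le (W := analyticFields E Q) hS
    (fun _ hX _ hY ↦ isAnalyticField_symProd hcov hX hY) hX

variable (E Q) in
/-- The vertical lift as a linear map. -/
def verticalLiftₗ :
    VField 𝓘(ℝ, E) Q →ₗ[ℝ] VField 𝓘(ℝ, E).tangent (TangentBundle 𝓘(ℝ, E) Q) where
  toFun := verticalLift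
  map_add' X Y := by
    funext v
    let u : E := v.snd
    let L : E →L[ℝ] E × E :=
      mfderiv 𝓘(ℝ, E) 𝓘(ℝ, E).tangent (fibreInclusion (Q := Q) v.proj) u
    exact L.map_add (X v.proj) (Y v.proj)
  map_smul' c X := by
    funext v
    let u : E := v.snd
    let L : E →L[ℝ] E × E :=
      mfderiv 𝓘(ℝ, E) 𝓘(ℝ, E).tangent (fibreInclusion (Q := Q) v.proj) u
    exact L.map_smul c (X v.proj)

lemma adSpray_succ (l : ℕ) (W : VField 𝓘(ℝ, E).tangent (TangentBundle 𝓘(ℝ, E) Q)) :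
    adSpray cov (l + 1) W =
      mlieBracket 𝓘(ℝ, E).tangent (geodesicSpray cov) (adSpray cov l W) :=
  Function.iterate_succ_apply' _ _ _

lemma verticalLift_mem_familyA {X : VField 𝓘(ℝ, E) Q} (hX : X ∈ symClosure cov S) :
    verticalLift X ∈ familyA cov S :=
  Submodule.subset_span ⟨X, hX, rfl⟩

lemma adSpray_mem_familyB (l : ℕ) {X : VField 𝓘(ℝ, E) Q} (hX : X ∈ symClosure cov S) :
    adSpray cov l (verticalLift X) ∈ familyB cov S :=
  Submodule.subset_span ⟨l, X, hX, rfl⟩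

lemma adSpray_succ_mem_familyC (l : ℕ) {X : VField 𝓘(ℝ, E) Q} (hX : X ∈ symClosure cov S) :
    adSpray cov (l + 1) (verticalLift X) ∈ familyC cov S :=
  subset_lieClosure _ ⟨l + 1, by omega, X, hX, rfl⟩

lemma adSpray_mem {W : Submodule ℝ (VField 𝓘(ℝ, E).tangent (TangentBundle 𝓘(ℝ, E) Q))}
    (hW : ∀ X ∈ W, mlieBracket 𝓘(ℝ, E).tangent (geodesicSpray cov) X ∈ W)
    {X : VField 𝓘(ℝ, E).tangent (TangentBundle 𝓘(ℝ, E) Q)} (hX : X ∈ W) (l : ℕ) :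
    adSpray cov l X ∈ W := by
  induction l with
  | zero => exact hX
  | succ l ih => rw [adSpray_succ]; exact hW _ ih

lemma familyA_le_familyB : familyA cov S ≤ familyB cov S := by
  refine Submodule.span_le.2 ?_
  rintro _ ⟨X, hX, rfl⟩
  exact adSpray_mem_familyB 0 hX

variable [FiniteDimensional ℝ E] (hcov : IsAnalyticConnection cov)
  (hS : ∀ X ∈ S, IsAnalyticField X)
include hcov

lemma adSpray_mem_smoothFields {X : VField 𝓘(ℝ, E) Q} (hX : IsAnalyticField X) (l : ℕ) :
    adSpray cov l (verticalLift X) ∈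
      smoothFields 𝓘(ℝ, E).tangent (TangentBundle 𝓘(ℝ, E) Q) :=
  have := FiniteDimensional.complete ℝ E
  adSpray_mem (fun _ h ↦ mlieBracket_mem_smoothFields (isSmoothField_geodesicSpray hcov) h)
    hX.isSmoothField_verticalLift l

include hS

lemma familyB_le_smoothFields :
    familyB cov S ≤ smoothFields 𝓘(ℝ, E).tangent (TangentBundle 𝓘(ℝ, E) Q) := by
  refine Submodule.span_le.2 ?_
  rintro _ ⟨l, X, hX, rfl⟩
  exact adSpray_mem_smoothFields hcov (isAnalyticField_of_mem_symClosure hcov hS hX) l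

lemma familyA_le_smoothFields :
    familyA cov S ≤ smoothFields 𝓘(ℝ, E).tangent (TangentBundle 𝓘(ℝ, E) Q) :=
  familyA_le_familyB.trans (familyB_le_smoothFields hcov hS)

lemma familyC_le_smoothFields :
    familyC cov S ≤ smoothFields 𝓘(ℝ, E).tangent (TangentBundle 𝓘(ℝ, E) Q) := by
  have := FiniteDimensional.complete ℝ E
  refine lieClosure_le_smoothFields ?_
  rintro _ ⟨l, -, X, hX, rfl⟩
  exact adSpray_mem_smoothFields hcov (isAnalyticField_of_mem_symClosure hcov hS hX) l

lemma spray_mlieBracket_familyB {X : VField 𝓘(ℝ, E).tangent (TangentBundle 𝓘(ℝ, E) Q)}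
    (hX : X ∈ familyB cov S) :
    mlieBracket 𝓘(ℝ, E).tangent (geodesicSpray cov) X ∈ familyB cov S := by
  have := FiniteDimensional.complete ℝ E
  have h : familyB cov S ≤ bracketComap {geodesicSpray cov} (familyB cov S) := by
    refine Submodule.span_le.2 ?_
    rintro _ ⟨l, X, hX, rfl⟩
    refine ⟨adSpray_mem_smoothFields hcov (isAnalyticField_of_mem_symClosure hcov hS hX) l, ?_⟩
    rintro _ rfl
    rw [← adSpray_succ]
    exact adSpray_mem_familyB (l + 1) hX
  exact (h hX).2 _ rfl

lemma spray_mlieBracket_familyA {X : VField 𝓘(ℝ, E).tangent (TangentBundle 𝓘(ℝ, E) Q)}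
    (hX : X ∈ familyA cov S) :
    mlieBracket 𝓘(ℝ, E).tangent (geodesicSpray cov) X ∈ familyC cov S := by
  have := FiniteDimensional.complete ℝ E
  have h : familyA cov S ≤ bracketComap {geodesicSpray cov} (familyC cov S) := by
    refine Submodule.span_le.2 ?_
    rintro _ ⟨X, hX, rfl⟩
    refine ⟨(isAnalyticField_of_mem_symClosure hcov hS hX).isSmoothField_verticalLift, ?_⟩
    rintro _ rfl
    exact adSpray_succ_mem_familyC 0 hX
  exact (h hX).2 _ rfl

/-- `ad_Z` is a derivation that maps the generators of `C` to generators of `C`, so it preserves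
`C`. -/
lemma spray_mlieBracket_familyC {X : VField 𝓘(ℝ, E).tangent (TangentBundle 𝓘(ℝ, E) Q)}
    (hX : X ∈ familyC cov S) :
    mlieBracket 𝓘(ℝ, E).tangent (geodesicSpray cov) X ∈ familyC cov S := by
  have := FiniteDimensional.complete ℝ E
  have hC := familyC_le_smoothFields hcov hS
  have h : familyC cov S ≤
      familyC cov S ⊓ bracketComap {geodesicSpray cov} (familyC cov S) := by
    refine lieClosure_le ?_ ?_
    · rintro _ ⟨l, hl, X, hX, rfl⟩
      have hl' : adSpray cov l (verticalLift X) ∈ familyC cov S :=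
        subset_lieClosure _ ⟨l, hl, X, hX, rfl⟩
      refine ⟨hl', hC hl', ?_⟩
      rintro _ rfl
      rw [← adSpray_succ]
      exact adSpray_succ_mem_familyC l hX
    · rintro X ⟨hX, hX'⟩ Y ⟨hY, hY'⟩
      have hXY := mlieBracket_mem_lieClosure hX hY
      refine ⟨hXY, hC hXY, ?_⟩
      rintro _ rfl
      rw [mlieBracket_leibniz (isSmoothField_geodesicSpray hcov) hX'.1 hY'.1]
      exact add_mem (mlieBracket_mem_lieClosure (hX'.2 _ rfl) hY)
        (mlieBracket_mem_lieClosure hX (hY'.2 _ rfl))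
  exact (h hX).2.2 _ rfl

/-- `ad_Z` maps `A + C` into `C`. -/
lemma spray_mlieBracket_sup {X : VField 𝓘(ℝ, E).tangent (TangentBundle 𝓘(ℝ, E) Q)}
    (hX : X ∈ familyA cov S ⊔ familyC cov S) :
    mlieBracket 𝓘(ℝ, E).tangent (geodesicSpray cov) X ∈ familyC cov S := by
  have := FiniteDimensional.complete ℝ E
  obtain ⟨a, ha, c, hc, rfl⟩ := Submodule.mem_sup.1 hX
  rw [mlieBracket_add_of_smooth (familyA_le_smoothFields hcov hS ha)
    (familyC_le_smoothFields hcov hS hc)]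
  exact add_mem (spray_mlieBracket_familyA hcov hS ha) (spray_mlieBracket_familyC hcov hS hc)

/-- The bracket of a vertical lift `X^V` with `ad_Z^l (Y^V)` vanishes for `l = 0` and is
`⟨X : Y⟩^V` for `l = 1`; for larger `l` the Jacobi identity reduces it to smaller `l`. -/
lemma mlieBracket_verticalLift_adSpray {X Y : VField 𝓘(ℝ, E) Q} (hX : X ∈ symClosure cov S)
    (hY : Y ∈ symClosure cov S) (l : ℕ) :
    mlieBracket 𝓘(ℝ, E).tangent (verticalLift X) (adSpray cov l (verticalLift Y)) ∈
      familyA cov S ⊔ familyC cov S := by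
  have := FiniteDimensional.complete ℝ E
  have hXa := isAnalyticField_of_mem_symClosure hcov hS hX
  have hYa := isAnalyticField_of_mem_symClosure hcov hS hY
  induction l with
  | zero =>
    rw [show adSpray cov 0 (verticalLift Y) = verticalLift Y from rfl,
      mlieBracket_verticalLift hXa hYa]
    exact zero_mem _
  | succ l ih =>
    obtain _ | l := l
    · refine Submodule.mem_sup_left ?_
      have h := mlieBracket_verticalLift_mlieBracket_spray hcov hXa hYa
      exact h ▸ verticalLift_mem_familyA (symProd_mem_symClosure hX hY)
    · rw [adSpray_succ, mlieBracket_leibniz hXa.isSmoothField_verticalLift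
        (isSmoothField_geodesicSpray hcov) (adSpray_mem_smoothFields hcov hYa (l + 1))]
      refine Submodule.mem_sup_right (add_mem ?_ (spray_mlieBracket_sup hcov hS ih))
      exact mlieBracket_mem_lieClosure
        (mlieBracket_mem_symm (adSpray_succ_mem_familyC 0 hX)) (adSpray_succ_mem_familyC l hY)

/-- `[A, C] ⊆ A + C`. The elements `c` of `C` with `[A, c] ⊆ A + C` are closed under the bracket by
the Jacobi identity, and the generators of `C` are among them. -/
lemma mlieBracket_familyA_familyC {X Y : VField 𝓘(ℝ, E).tangent (TangentBundle 𝓘(ℝ, E) Q)}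
    (hX : X ∈ familyA cov S) (hY : Y ∈ familyC cov S) :
    mlieBracket 𝓘(ℝ, E).tangent X Y ∈ familyA cov S ⊔ familyC cov S := by
  have := FiniteDimensional.complete ℝ E
  have hA := familyA_le_smoothFields hcov hS
  have hC := familyC_le_smoothFields hcov hS
  have h : familyC cov S ≤ familyC cov S ⊓
      bracketComap (familyA cov S : Set _) (familyA cov S ⊔ familyC cov S) := by
    refine lieClosure_le ?_ ?_
    · rintro _ ⟨l, hl, Y, hY, rfl⟩
      have hl' : adSpray cov l (verticalLift Y) ∈ familyC cov S :=
        subset_lieClosure _ ⟨l, hl, Y, hY, rfl⟩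
      refine ⟨hl', hC hl', fun X hX ↦ ?_⟩
      refine mlieBracket_mem_of_mem_span (Submodule.span_le.1 hA) ?_ hX
      rintro _ ⟨X, hX, rfl⟩
      exact mlieBracket_verticalLift_adSpray hcov hS hX hY l
    · rintro Y ⟨hY, hY'⟩ Y₁ ⟨hY₁, hY₁'⟩
      have hYY := mlieBracket_mem_lieClosure hY hY₁
      refine ⟨hYY, hC hYY, fun X hX ↦ ?_⟩
      -- An element that brackets `A` into `A + C` and lies in `C` also brackets `A + C` into it.
      have key : ∀ c ∈ familyC cov S, (∀ X ∈ familyA cov S,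
          mlieBracket 𝓘(ℝ, E).tangent X c ∈ familyA cov S ⊔ familyC cov S) →
          ∀ n ∈ familyA cov S ⊔ familyC cov S,
          mlieBracket 𝓘(ℝ, E).tangent n c ∈ familyA cov S ⊔ familyC cov S := by
        intro c hc hc' n hn
        obtain ⟨a, ha, d, hd, rfl⟩ := Submodule.mem_sup.1 hn
        rw [add_mlieBracket_of_smooth (hA ha) (hC hd)]
        exact add_mem (hc' a ha) (Submodule.mem_sup_right (mlieBracket_mem_lieClosure hd hc))
      rw [mlieBracket_leibniz (hA hX) hY'.1 hY₁'.1]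
      exact add_mem (key Y₁ hY₁ hY₁'.2 _ (hY'.2 X hX))
        (mlieBracket_mem_symm (key Y hY hY'.2 _ (hY₁'.2 X hX)))
  exact (h hY).2.2 X hX

lemma mlieBracket_familyA {X Y : VField 𝓘(ℝ, E).tangent (TangentBundle 𝓘(ℝ, E) Q)}
    (hX : X ∈ familyA cov S) (hY : Y ∈ familyA cov S) :
    mlieBracket 𝓘(ℝ, E).tangent X Y ∈ familyA cov S ⊔ familyC cov S := by
  have := FiniteDimensional.complete ℝ E
  have hA := familyA_le_smoothFields hcov hS
  refine mlieBracket_mem_of_mem_span (Submodule.span_le.1 hA) ?_ hX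
  rintro _ ⟨X, hX, rfl⟩
  refine mlieBracket_mem_symm (mlieBracket_mem_of_mem_span (Submodule.span_le.1 hA) ?_ hY)
  rintro _ ⟨Y, hY, rfl⟩
  exact mlieBracket_verticalLift_adSpray hcov hS hY hX 0

/-- Since `[X^V, [Z, Y^V]] = ⟨X : Y⟩^V`, the fields whose vertical lift is in the accessibility
algebra are closed under the symmetric product. -/
lemma verticalLift_mem_accessibilityAlgebra {X : VField 𝓘(ℝ, E) Q}
    (hX : X ∈ symClosure cov S) : verticalLift X ∈ accessibilityAlgebra cov S := by
  have h : symClosure cov S ≤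
      analyticFields E Q ⊓ (accessibilityAlgebra cov S).comap (verticalLiftₗ E Q) := by
    refine symClosure_le ?_ ?_
    · exact fun X hX ↦ ⟨hS X hX, subset_lieClosure _ (Or.inr ⟨X, hX, rfl⟩)⟩
    · rintro X ⟨hX, hX'⟩ Y ⟨hY, hY'⟩
      refine ⟨isAnalyticField_symProd hcov hX hY, ?_⟩
      change verticalLift (symProd cov X Y) ∈ accessibilityAlgebra cov S
      rw [← mlieBracket_verticalLift_mlieBracket_spray hcov hX hY]
      exact mlieBracket_mem_lieClosure hX'
        (mlieBracket_mem_lieClosure (subset_lieClosure _ (Or.inl rfl)) hY')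
  exact (h hX).2

/-- The accessibility algebra is `ℝ Z + A + B + C` already as a space of vector fields, before
evaluation at a point. -/
theorem accessibilityAlgebra_eq_sup :
    accessibilityAlgebra cov S =
      Submodule.span ℝ {geodesicSpray cov} ⊔ familyA cov S ⊔ familyB cov S ⊔ familyC cov S := by
  have := FiniteDimensional.complete ℝ E
  have hZ : geodesicSpray cov ∈ accessibilityAlgebra cov S := subset_lieClosure _ (Or.inl rfl)
  have hZs := isSmoothField_geodesicSpray hcov
  have had : ∀ (l : ℕ), ∀ X ∈ symClosure cov S,
      adSpray cov l (verticalLift X) ∈ accessibilityAlgebra cov S := fun l X hX ↦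
    adSpray_mem (fun _ h ↦ mlieBracket_mem_lieClosure hZ h)
      (verticalLift_mem_accessibilityAlgebra hcov hS hX) l
  have hB : familyB cov S ≤ accessibilityAlgebra cov S := by
    refine Submodule.span_le.2 ?_
    rintro _ ⟨l, X, hX, rfl⟩
    exact had l X hX
  have hA := familyA_le_smoothFields hcov hS
  have hC := familyC_le_smoothFields hcov hS
  refine le_antisymm ?_ (sup_le (sup_le (sup_le ?_ (familyA_le_familyB.trans hB)) hB) ?_)
  · have hN : Submodule.span ℝ {geodesicSpray cov} ⊔ (familyA cov S ⊔ familyC cov S) ≤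
        Submodule.span ℝ {geodesicSpray cov} ⊔ familyA cov S ⊔ familyB cov S ⊔
          familyC cov S :=
      sup_le (le_sup_left.trans (le_sup_left.trans le_sup_left))
        (sup_le (le_sup_right.trans (le_sup_left.trans le_sup_left)) le_sup_right)
    have hAC : ∀ X ∈ familyA cov S ⊔ familyC cov S, ∀ Y ∈ familyA cov S ⊔ familyC cov S,
        mlieBracket 𝓘(ℝ, E).tangent X Y ∈ familyA cov S ⊔ familyC cov S :=
      mlieBracket_mem_sup hA hC (fun X hX Y hY ↦ mlieBracket_familyA hcov hS hX hY)
        (fun X hX Y hY ↦ mlieBracket_familyA_familyC hcov hS hX hY)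
        (fun X hX Y hY ↦ Submodule.mem_sup_right (mlieBracket_mem_lieClosure hX hY))
    have hZ1 : ({geodesicSpray cov} : Set _) ⊆
        (smoothFields 𝓘(ℝ, E).tangent (TangentBundle 𝓘(ℝ, E) Q) : Set _) :=
      singleton_subset_iff.2 hZs
    refine (lieClosure_le ?_ (mlieBracket_mem_sup (Submodule.span_le.2 hZ1) (sup_le hA hC)
      ?_ ?_ (fun X hX Y hY ↦ Submodule.mem_sup_right (hAC X hX Y hY)))).trans hN
    · rintro _ (rfl | ⟨X, hX, rfl⟩)
      · exact Submodule.mem_sup_left (Submodule.mem_span_singleton_self _)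
      · exact Submodule.mem_sup_right
          (Submodule.mem_sup_left (verticalLift_mem_familyA (subset_symClosure S hX)))
    · intro X hX Y hY
      refine mlieBracket_mem_of_mem_span hZ1 ?_ hX
      rintro _ rfl
      refine mlieBracket_mem_symm (mlieBracket_mem_of_mem_span hZ1 ?_ hY)
      rintro _ rfl
      rw [mlieBracket_self]
      exact zero_mem _
    · intro X hX Y hY
      refine Submodule.mem_sup_right (mlieBracket_mem_of_mem_span hZ1 ?_ hX)
      rintro _ rfl
      exact Submodule.mem_sup_right (spray_mlieBracket_sup hcov hS hY)
  · exact (Submodule.span_singleton_le_iff_mem _ _).2 hZ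
  · refine lieClosure_le ?_ fun _ hX _ hY ↦ mlieBracket_mem_lieClosure hX hY
    rintro _ ⟨l, -, X, hX, rfl⟩
    exact had l X hX

theorem isLeast_familyB :
    IsLeast {W | familyA cov S ≤ W ∧
        ∀ X ∈ W, mlieBracket 𝓘(ℝ, E).tangent (geodesicSpray cov) X ∈ W} (familyB cov S) := by
  refine ⟨⟨familyA_le_familyB, fun X hX ↦ spray_mlieBracket_familyB hcov hS hX⟩, ?_⟩
  rintro W ⟨hA, hW⟩
  refine Submodule.span_le.2 ?_
  rintro _ ⟨l, X, hX, rfl⟩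
  exact adSpray_mem hW (hA (verticalLift_mem_familyA hX)) l

end Accessibility

end AffineControl
end

theorem mainTheorem2 {E : Type*} [NormedAddCommGroup E] [NormedSpace ℝ E] [FiniteDimensional ℝ E]
    {Q : Type*} [TopologicalSpace Q] [T2Space Q] [ParacompactSpace Q] [ChartedSpace E Q]
    [IsManifold 𝓘(ℝ, E) ω Q]
    (cov : CovariantDerivative 𝓘(ℝ, E) E (TangentSpace 𝓘(ℝ, E) : Q → Type _))
    (hcov : AffineControl.IsAnalyticConnection cov)
    {r : ℕ} (Y : Fin r → AffineControl.VField 𝓘(ℝ, E) Q)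
    (hY : ∀ a, AffineControl.IsAnalyticField (Y a)) :
    (∀ v : TangentBundle 𝓘(ℝ, E) Q,
      AffineControl.valuesAt (AffineControl.accessibilityAlgebra cov (Set.range Y)) v =
        Submodule.span ℝ {AffineControl.geodesicSpray cov v} ⊔
          AffineControl.valuesAt (AffineControl.familyA cov (Set.range Y)) v ⊔
          AffineControl.valuesAt (AffineControl.familyB cov (Set.range Y)) v ⊔
          AffineControl.valuesAt (AffineControl.familyC cov (Set.range Y)) v) ∧
    IsLeast {W | AffineControl.familyA cov (Set.range Y) ≤ W ∧
        ∀ X ∈ W, VectorField.mlieBracket 𝓘(ℝ, E).tangent (AffineControl.geodesicSpray cov) X ∈ W}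
      (AffineControl.familyB cov (Set.range Y)) := by
  have hS : ∀ X ∈ Set.range Y, AffineControl.IsAnalyticField X := by
    rintro _ ⟨a, rfl⟩
    exact hY a
  refine ⟨fun v ↦ ?_, AffineControl.isLeast_familyB hcov hS⟩
  rw [AffineControl.accessibilityAlgebra_eq_sup hcov hS]
  simp only [AffineControl.valuesAt, Submodule.map_sup, Submodule.map_span, Set.image_singleton]
  rfl
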